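/- Let $X$ be a nonnegative real random variable with a continuous distribution (i.e. one that has a density $f$ with respect to Lebesgue measure) with monotone hazard rate (MHR): writing $F$ for its cumulative distribution function, for a suitable version of $f$ the hazard rate $h(x)=\frac{f(x)}{1-F(x)}$ is non-decreasing on $\{x : F(x)<1\}$. For integers $1\le r\le n$ let $X_{r:n}$ be the $r$-th highest of $n$ i.i.d. samples from $X$ (so $X_{1:n}$ is the maximum). The support of $X$ may be unbounded. Then every $X_{r:n}$ has finite expectation, and (1) $\mathbb{E}[X_{2:4n}]\ge \mathbb{E}[X_{1:n}]$ for all $n\ge 1$; (2) $\mathbb{E}[X_{2:n+1}]\ge \frac1e\,\mathbb{E}[X_{1:n}]$ for all $n\ge 1$; (3) $\mathbb{E}[X_{2:n}]\ge \frac13\,\mathbb{E}[X_{1:n}]$ for all $n\ge 2$. Moreover, the number $4n$ of samples in (1) cannot be lowered in general, already for $n=1$: there is a continuous MHR distribution with support contained in a bounded interval $[0,V]$ such that $\mathbb{E}[X_{2:m}]<\mathbb{E}[X_{1:1}]=\mathbb{E}[X]$ for every $m$ with $2\le m<4$. -/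

import Mathlib

/-- The hazard rate `h(x) = f(x) / (1 - F(x))` of a probability distribution `μ` on `ℝ` with
density `f` and cumulative distribution function `F`. -/
noncomputable def hazardRate (μ : MeasureTheory.Measure ℝ) (f : ℝ → ℝ) (x : ℝ) : ℝ :=
  f x / (1 - ProbabilityTheory.cdf μ x)

/-- `μ` is a continuous distribution with monotone hazard rate: it has a (real-valued, nonnegative)
density with respect to Lebesgue measure, a version of which makes the hazard rate non-decreasing
wherever the hazard rate is defined, that is, on `{x | F(x) < 1}`. -/
def IsMHR (μ : MeasureTheory.Measure ℝ) : Prop :=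
  ∃ f : ℝ → ℝ, Measurable f ∧ (∀ x, 0 ≤ f x) ∧
    μ = MeasureTheory.volume.withDensity (fun x => ENNReal.ofReal (f x)) ∧
    MonotoneOn (hazardRate μ f) {x | ProbabilityTheory.cdf μ x < 1}

/-- The `r`-th highest of the values `v 0, …, v (n - 1)`, for `1 ≤ r ≤ n`
(so `r = 1` is the maximum). Here `v ∘ Tuple.sort v` lists the values in non-decreasing order.
Outside the range `1 ≤ r ≤ n` the value is set to `0`. -/
noncomputable def orderStat (r : ℕ) {n : ℕ} (v : Fin n → ℝ) : ℝ :=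
  if h : 1 ≤ r ∧ r ≤ n then v (Tuple.sort v ⟨n - r, by omega⟩) else 0

/-- The joint law of `n` independent samples from `μ`. -/
noncomputable def iidLaw (μ : MeasureTheory.Measure ℝ) (n : ℕ) :
    MeasureTheory.Measure (Fin n → ℝ) :=
  MeasureTheory.Measure.pi (fun _ : Fin n => μ)

/-- `E[X_{r:n}]`: the expected `r`-th highest of `n` independent samples from `μ`. -/
noncomputable def expectedOrderStat (μ : MeasureTheory.Measure ℝ) (r n : ℕ) : ℝ :=
  ∫ v, orderStat r v ∂(iidLaw μ n)

open MeasureTheory ProbabilityTheory Set Filter Topology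

/-! ### Order statistics -/

/-! Write `F` for the cdf and `q = F x`. Tail integration turns `E[X_{2:m}] - a E[X_{1:n}]` into `∫
(1 - F) g(F)`, where `g` is the polynomial `q ^ j * (c * (1 + ... + q ^ (k - 1)) - b * q ^ k)`,
which changes sign once on `[0, 1]`, from plus to minus. Let `η` be the hazard rate at a point where
`F` equals the crossing value. Monotonicity gives `f ≤ η (1 - F)` before that point and `f ≥ η (1 -
F)` after it, so `g(F) f ≤ η (1 - F) g(F)` everywhere. Integrating gives `∫₀¹ g ≤ η ∫ (1 - F) g(F)`
(`integral_tail_mul_nonneg`). The left side is the value for the rate-one exponential law, so that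
law is the worst case, and each inequality reduces to a bound on harmonic sums. For sharpness, the
density `2 (1 - x)` on `[0, 1]` has mean `1/3`, while the second highest of two or three samples has
mean `1/5` or `11/35`. -/

theorem orderStat_le_iff {r n : ℕ} (hr : 1 ≤ r) (hrn : r ≤ n) (v : Fin n → ℝ) (x : ℝ) :
    orderStat r v ≤ x ↔ (Finset.univ.filter fun i => x < v i).card < r := by
  rw [orderStat, dif_pos ⟨hr, hrn⟩]
  have h1 := Tuple.lt_card_le_iff_apply_le_of_monotone (f := v ∘ Tuple.sort v) (a := x)
    (j := (⟨n - r, by omega⟩ : Fin n)) (Tuple.monotone_sort v)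
  rw [Function.comp_apply] at h1
  rw [← h1]
  have h2 : (Finset.univ.filter fun i => (v ∘ Tuple.sort v) i ≤ x).card
      = (Finset.univ.filter fun i => v i ≤ x).card :=
    Finset.card_equiv (Tuple.sort v) (by simp)
  have h3 := Finset.card_filter_add_card_filter_not (s := (Finset.univ : Finset (Fin n)))
    (fun i => v i ≤ x)
  simp only [not_le, Finset.card_univ, Fintype.card_fin] at h3
  rw [h2]
  simp only
  omega

theorem measurable_orderStat {r n : ℕ} (hr : 1 ≤ r) (hrn : r ≤ n) :
    Measurable (fun v : Fin n → ℝ => orderStat r v) := by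
  refine measurable_of_Iic fun x => ?_
  have h : (fun v : Fin n → ℝ => orderStat r v) ⁻¹' Iic x
      = (fun v : Fin n → ℝ => ∑ i, (Ioi x).indicator (fun _ => (1 : ℝ)) (v i)) ⁻¹' Iio (r : ℝ) := by
    ext v
    simp only [mem_preimage, mem_Iic, orderStat_le_iff hr hrn, mem_Iio, indicator_apply, mem_Ioi]
    rw [Finset.sum_boole]
    exact Nat.cast_lt.symm
  rw [h]
  refine measurableSet_preimage ?_ measurableSet_Iio
  refine Finset.measurable_sum _ fun i _ => ?_
  exact (measurable_const.indicator measurableSet_Ioi).comp (measurable_pi_apply i)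

theorem exists_orderStat_eq {r n : ℕ} (hr : 1 ≤ r) (hrn : r ≤ n) (v : Fin n → ℝ) :
    ∃ i, orderStat r v = v i :=
  ⟨_, by rw [orderStat, dif_pos ⟨hr, hrn⟩]⟩

theorem integrable_orderStat {μ : Measure ℝ} [IsProbabilityMeasure μ]
    (hμ : Integrable (fun x => x) μ) {r n : ℕ} (hr : 1 ≤ r) (hrn : r ≤ n) :
    Integrable (fun v : Fin n → ℝ => orderStat r v) (iidLaw μ n) := by
  have h : Integrable (fun v : Fin n → ℝ => ∑ i, |v i|) (iidLaw μ n) :=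
    integrable_finsetSum _ fun i _ =>
      (integrable_comp_eval (μ := fun _ : Fin n => μ) (i := i) (f := fun x : ℝ => x) hμ).abs
  refine h.mono' (measurable_orderStat hr hrn).aestronglyMeasurable (ae_of_all _ fun v => ?_)
  obtain ⟨i, hi⟩ := exists_orderStat_eq hr hrn v
  rw [hi, Real.norm_eq_abs]
  exact Finset.single_le_sum (f := fun i => |v i|) (fun _ _ => abs_nonneg _) (Finset.mem_univ i)

theorem orderStat_nonneg_ae {μ : Measure ℝ} [IsProbabilityMeasure μ]
    (h0 : ∀ᵐ x ∂μ, 0 ≤ x) {r n : ℕ} (hr : 1 ≤ r) (hrn : r ≤ n) :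
    ∀ᵐ v ∂(iidLaw μ n), 0 ≤ orderStat r v := by
  have h : ∀ᵐ v ∂(iidLaw μ n), ∀ i, 0 ≤ v i := by
    rw [ae_all_iff]
    intro i
    exact (measurePreserving_eval (fun _ : Fin n => μ) i).quasiMeasurePreserving.ae h0
  filter_upwards [h] with v hv
  obtain ⟨i, hi⟩ := exists_orderStat_eq hr hrn v
  exact hi ▸ hv i

theorem iidLaw_real_pi (μ : Measure ℝ) [IsProbabilityMeasure μ] {n : ℕ} (s : Fin n → Set ℝ) :
    (iidLaw μ n).real (univ.pi s) = ∏ i, μ.real (s i) := by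
  simp only [iidLaw, measureReal_def, Measure.pi_pi, ENNReal.toReal_prod]

theorem iidLaw_real_orderStat_one_le (μ : Measure ℝ) [IsProbabilityMeasure μ] {n : ℕ}
    (hn : 1 ≤ n) (x : ℝ) :
    (iidLaw μ n).real {v | orderStat 1 v ≤ x} = cdf μ x ^ n := by
  have h : {v : Fin n → ℝ | orderStat 1 v ≤ x} = univ.pi fun _ => Iic x := by
    ext v
    simp [orderStat_le_iff le_rfl hn, Finset.filter_eq_empty_iff, Pi.le_def]
  rw [h, iidLaw_real_pi]
  simp [cdf_eq_real]

/-- At most one sample exceeds `x`: either none does (`A`), or exactly the `i`-th does (`B i`), and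
these boxes are disjoint. -/
theorem iidLaw_real_orderStat_two_le (μ : Measure ℝ) [IsProbabilityMeasure μ] {n : ℕ}
    (hn : 2 ≤ n) (x : ℝ) :
    (iidLaw μ n).real {v | orderStat 2 v ≤ x}
      = cdf μ x ^ n + n * (cdf μ x ^ (n - 1) * (1 - cdf μ x)) := by
  have : IsProbabilityMeasure (iidLaw μ n) := by unfold iidLaw; infer_instance
  set A : Set (Fin n → ℝ) := univ.pi fun _ => Iic x with hA
  set B : Fin n → Set (Fin n → ℝ) :=
    fun i => univ.pi (Function.update (fun _ => Iic x) i (Ioi x)) with hB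
  have memB : ∀ i v, v ∈ B i ↔ ∀ j, x < v j ↔ j = i := by
    intro i v
    simp only [hB, mem_univ_pi]
    refine forall_congr' fun j => ?_
    by_cases hj : j = i
    · subst hj; simp
    · simp [hj]
  have h : {v : Fin n → ℝ | orderStat 2 v ≤ x} = A ∪ ⋃ i, B i := by
    ext v
    simp only [mem_ofPred_eq, orderStat_le_iff one_le_two hn, mem_union, mem_iUnion, memB]
    rw [show ∀ k : ℕ, k < 2 ↔ k = 0 ∨ k = 1 by omega, Finset.card_eq_zero, Finset.card_eq_one,
      Finset.filter_eq_empty_iff]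
    refine or_congr (by simp [hA, Pi.le_def]) (exists_congr fun i => ?_)
    simp [Finset.ext_iff]
  have mB : ∀ i, MeasurableSet (B i) := by
    intro i
    refine MeasurableSet.univ_pi fun j => ?_
    by_cases hj : j = i
    · subst hj; simp
    · simp [hj]
  have dB : Pairwise (Function.onFun Disjoint B) := by
    intro i j hij
    refine Set.disjoint_left.2 fun v hi hj => hij ?_
    rw [memB] at hi hj
    exact (hj i).1 ((hi i).2 rfl)
  have dAB : Disjoint A (⋃ i, B i) := by
    refine Set.disjoint_left.2 fun v hv hv' => ?_
    obtain ⟨i, hi⟩ := mem_iUnion.1 hv'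
    exact absurd (((memB i v).1 hi i).2 rfl) (not_lt.2 (hv i (mem_univ i)))
  have hBi : ∀ i, (iidLaw μ n).real (B i) = cdf μ x ^ (n - 1) * (1 - cdf μ x) := by
    intro i
    rw [hB]
    simp only
    rw [iidLaw_real_pi]
    have h1 : ∀ j, μ.real (Function.update (fun _ => Iic x) i (Ioi x) j)
        = Function.update (fun _ => cdf μ x) i (1 - cdf μ x) j := by
      intro j
      by_cases hj : j = i
      · subst hj
        simp only [Function.update_self]
        rw [← compl_Iic, probReal_compl_eq_one_sub measurableSet_Iic, cdf_eq_real]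
      · simp [hj, cdf_eq_real]
    rw [Finset.prod_congr rfl fun j _ => h1 j, Finset.prod_update_of_mem (Finset.mem_univ i)]
    simp [Finset.card_sdiff, mul_comm]
  rw [h, measureReal_union dAB (MeasurableSet.iUnion mB), hA, iidLaw_real_pi,
    measureReal_iUnion_fintype dB mB, Finset.sum_congr rfl fun i _ => hBi i]
  simp [cdf_eq_real]

theorem expectedOrderStat_eq_integral {μ : Measure ℝ} [IsProbabilityMeasure μ]
    (h0 : ∀ᵐ x ∂μ, 0 ≤ x) (hμ : Integrable (fun x => x) μ) {r n : ℕ} (hr : 1 ≤ r)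
    (hrn : r ≤ n) :
    expectedOrderStat μ r n = ∫ x in Ioi 0, (1 - (iidLaw μ n).real {v | orderStat r v ≤ x}) := by
  have : IsProbabilityMeasure (iidLaw μ n) := by unfold iidLaw; infer_instance
  rw [expectedOrderStat,
    (integrable_orderStat hμ hr hrn).integral_eq_integral_meas_lt (orderStat_nonneg_ae h0 hr hrn)]
  refine integral_congr_ae (ae_of_all _ fun x => ?_)
  simp only
  rw [← probReal_compl_eq_one_sub (measurableSet_le (measurable_orderStat hr hrn)
    measurable_const)]
  congr 1
  ext v
  simp

theorem expectedOrderStat_one {μ : Measure ℝ} [IsProbabilityMeasure μ]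
    (h0 : ∀ᵐ x ∂μ, 0 ≤ x) (hμ : Integrable (fun x => x) μ) {n : ℕ} (hn : 1 ≤ n) :
    expectedOrderStat μ 1 n = ∫ x in Ioi 0, (1 - cdf μ x ^ n) := by
  rw [expectedOrderStat_eq_integral h0 hμ le_rfl hn]
  simp only [iidLaw_real_orderStat_one_le μ hn]

theorem expectedOrderStat_two {μ : Measure ℝ} [IsProbabilityMeasure μ]
    (h0 : ∀ᵐ x ∂μ, 0 ≤ x) (hμ : Integrable (fun x => x) μ) {n : ℕ} (hn : 2 ≤ n) :
    expectedOrderStat μ 2 n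
      = ∫ x in Ioi 0, (1 - (cdf μ x ^ n + n * (cdf μ x ^ (n - 1) * (1 - cdf μ x)))) := by
  rw [expectedOrderStat_eq_integral h0 hμ one_le_two hn]
  simp only [iidLaw_real_orderStat_two_le μ hn]

/-! ### Continuous distributions on the half-line -/

theorem continuous_cdf (μ : Measure ℝ) [IsProbabilityMeasure μ] [NullSingletonClass μ] :
    Continuous (cdf μ) := by
  refine continuous_iff_continuousAt.2 fun a => ?_
  have h := (cdf μ).measure_singleton a
  rw [measure_cdf, measure_singleton, eq_comm, ENNReal.ofReal_eq_zero, sub_nonpos] at h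
  rw [(monotone_cdf μ).continuousAt_iff_leftLim_eq_rightLim, StieltjesFunction.rightLim_eq]
  exact le_antisymm ((monotone_cdf μ).leftLim_le le_rfl) h

theorem cdf_zero_of_nonneg {μ : Measure ℝ} [IsProbabilityMeasure μ] [NullSingletonClass μ]
    (h0 : ∀ᵐ x ∂μ, 0 ≤ x) : cdf μ 0 = 0 := by
  have h : μ (Iio 0) = 0 := by
    simpa [ae_iff, Iio_def] using h0
  rw [cdf_eq_real, measureReal_def, ← measure_congr Iio_ae_eq_Iic, h, ENNReal.toReal_zero]

theorem exists_cdf_eq {μ : Measure ℝ} [IsProbabilityMeasure μ] [NullSingletonClass μ]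
    {a q : ℝ} (ha : cdf μ a ≤ q) (h1 : q < 1) : ∃ x, a ≤ x ∧ cdf μ x = q := by
  obtain ⟨b, hab, hb⟩ :=
    ((eventually_ge_atTop a).and ((tendsto_cdf_atTop μ).eventually (lt_mem_nhds h1))).exists
  obtain ⟨x, hx, hxq⟩ :=
    intermediate_value_Icc hab (continuous_cdf μ).continuousOn ⟨ha, hb.le⟩
  exact ⟨x, hx.1, hxq⟩

/-- Probability integral transform. `F` need not be strictly increasing: by continuity, for `0 ≤ t <
1` the set `{F ≤ t}` is a half-line whose largest point has `F = t`. -/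
theorem map_cdf_eq {μ : Measure ℝ} [IsProbabilityMeasure μ] [NullSingletonClass μ]
    (h0 : ∀ᵐ x ∂μ, 0 ≤ x) : μ.map (cdf μ) = volume.restrict (Ioc 0 1) := by
  have hc := continuous_cdf μ
  have : IsProbabilityMeasure (μ.map (cdf μ)) :=
    Measure.isProbabilityMeasure_map hc.measurable.aemeasurable
  refine Measure.ext_of_Iic _ _ fun t => ?_
  rw [Measure.map_apply hc.measurable measurableSet_Iic,
    Measure.restrict_apply measurableSet_Iic]
  rcases lt_or_ge t 0 with ht | ht
  · have h1 : cdf μ ⁻¹' Iic t = ∅ := by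
      ext x
      simpa using ht.trans_le (cdf_nonneg μ x)
    have h2 : Iic t ∩ Ioc (0 : ℝ) 1 = ∅ := by
      ext x
      simp only [mem_inter_iff, mem_Iic, mem_Ioc, mem_empty_iff_false, iff_false]
      intro h
      linarith [h.1, h.2.1]
    rw [h1, h2, measure_empty, measure_empty]
  rcases lt_or_ge t 1 with ht1 | ht1
  · have hA : IsGreatest (cdf μ ⁻¹' Iic t) (sSup (cdf μ ⁻¹' Iic t)) := by
      obtain ⟨b, hb⟩ := ((tendsto_cdf_atTop μ).eventually (lt_mem_nhds ht1)).exists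
      have hbdd : BddAbove (cdf μ ⁻¹' Iic t) :=
        ⟨b, fun x hx => le_of_lt ((monotone_cdf μ).reflect_lt (lt_of_le_of_lt hx hb))⟩
      refine ⟨(isClosed_Iic.preimage hc).csSup_mem ⟨0, ?_⟩ hbdd, fun x hx => le_csSup hbdd hx⟩
      simpa [cdf_zero_of_nonneg h0] using ht
    set y := sSup (cdf μ ⁻¹' Iic t)
    have hy : cdf μ y = t := by
      obtain ⟨x, hyx, hx⟩ := exists_cdf_eq hA.1 ht1
      rw [← hx]
      exact congrArg _ (le_antisymm hyx (hA.2 hx.le))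
    have hS : cdf μ ⁻¹' Iic t = Iic y :=
      Subset.antisymm (fun x hx => hA.2 hx) fun x hx => (monotone_cdf μ hx).trans hy.le
    have h2 : Iic t ∩ Ioc (0 : ℝ) 1 = Ioc 0 t := by
      rw [inter_comm, Ioc_inter_Iic, min_eq_right ht1.le]
    rw [hS, h2, ← ofReal_cdf, hy, Real.volume_Ioc, sub_zero]
  · have h1 : cdf μ ⁻¹' Iic t = univ := by
      ext x
      simpa using (cdf_le_one μ x).trans ht1
    have h2 : Iic t ∩ Ioc (0 : ℝ) 1 = Ioc 0 1 := by
      rw [inter_comm, Ioc_inter_Iic, min_eq_left ht1]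
    rw [h1, h2, measure_univ]
    simp

theorem integral_comp_cdf {μ : Measure ℝ} [IsProbabilityMeasure μ] [NullSingletonClass μ]
    (h0 : ∀ᵐ x ∂μ, 0 ≤ x) {g : ℝ → ℝ} (hg : Continuous g) :
    ∫ x, g (cdf μ x) ∂μ = ∫ q in (0 : ℝ)..1, g q := by
  rw [intervalIntegral.integral_of_le zero_le_one, ← map_cdf_eq h0,
    integral_map (continuous_cdf μ).measurable.aemeasurable hg.aestronglyMeasurable]

theorem integrable_id_of_integrableOn_tail {μ : Measure ℝ} [IsProbabilityMeasure μ]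
    (h0 : ∀ᵐ x ∂μ, 0 ≤ x) (hS : IntegrableOn (fun x => 1 - cdf μ x) (Ioi 0)) :
    Integrable (fun x => x) μ := by
  refine ⟨aestronglyMeasurable_id, ?_⟩
  rw [hasFiniteIntegral_iff_ofReal h0, lintegral_eq_lintegral_meas_lt μ h0 aemeasurable_id']
  refine lt_of_eq_of_lt (lintegral_congr fun x => ?_) hS.lintegral_lt_top
  rw [cdf_eq_real, ← probReal_compl_eq_one_sub measurableSet_Iic, compl_Iic,
    ofReal_measureReal]
  rfl

/-! ### Monotone hazard rate -/

/-- The defining data of `IsMHR` for a fixed version `f` of the density. -/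
structure IsMHRDensity (μ : Measure ℝ) (f : ℝ → ℝ) : Prop where
  measurable : Measurable f
  nonneg : ∀ x, 0 ≤ f x
  eq_withDensity : μ = volume.withDensity fun x => ENNReal.ofReal (f x)
  monotoneOn : MonotoneOn (hazardRate μ f) {x | cdf μ x < 1}

namespace IsMHRDensity

variable {μ : Measure ℝ} {f : ℝ → ℝ}

theorem nullSingletonClass (h : IsMHRDensity μ f) : NullSingletonClass μ := by
  rw [h.eq_withDensity]
  infer_instance

theorem integrable [IsProbabilityMeasure μ] (h : IsMHRDensity μ f) : Integrable f := by
  refine ⟨h.measurable.aestronglyMeasurable, ?_⟩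
  rw [hasFiniteIntegral_iff_ofReal (ae_of_all _ h.nonneg)]
  have h1 : μ univ = 1 := measure_univ
  rw [h.eq_withDensity, withDensity_apply _ MeasurableSet.univ, Measure.restrict_univ] at h1
  rw [h1]
  exact ENNReal.one_lt_top

theorem integral_eq (h : IsMHRDensity μ f) (g : ℝ → ℝ) : ∫ x, g x ∂μ = ∫ x, g x * f x := by
  conv_lhs => rw [h.eq_withDensity]
  rw [integral_withDensity_eq_integral_toReal_smul h.measurable.ennreal_ofReal
    (ae_of_all _ fun _ => ENNReal.ofReal_lt_top)]
  refine integral_congr_ae (ae_of_all _ fun x => ?_)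
  simp only [ENNReal.toReal_ofReal (h.nonneg x), smul_eq_mul, mul_comm]

theorem density_le (h : IsMHRDensity μ f) {x y : ℝ} (hxy : x ≤ y) (hy : cdf μ y < 1) :
    f x ≤ hazardRate μ f y * (1 - cdf μ x) := by
  have hx : cdf μ x < 1 := (monotone_cdf μ hxy).trans_lt hy
  rw [← div_le_iff₀ (sub_pos.2 hx)]
  exact h.monotoneOn hx hy hxy

theorem le_density (h : IsMHRDensity μ f) {x y : ℝ} (hxy : x ≤ y) (hx : cdf μ x < 1) :
    hazardRate μ f x * (1 - cdf μ y) ≤ f y := by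
  rcases (cdf_le_one μ y).lt_or_eq with hy | hy
  · rw [← le_div_iff₀ (sub_pos.2 hy)]
    exact h.monotoneOn hx hy hxy
  · rw [hy, sub_self, mul_zero]
    exact h.nonneg y

/-- A zero hazard rate at `x` would, by monotonicity, force `f = 0` on all of `Iic x`, hence `F x =
0`. -/
theorem hazardRate_pos [IsProbabilityMeasure μ] (h : IsMHRDensity μ f) {x : ℝ}
    (hx : 0 < cdf μ x) (hx1 : cdf μ x < 1) : 0 < hazardRate μ f x := by
  have h0 : 0 ≤ hazardRate μ f x := div_nonneg (h.nonneg x) (sub_pos.2 hx1).le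
  refine h0.lt_of_ne fun heq => hx.ne' ?_
  have hf : ∀ y ∈ Iic x, ENNReal.ofReal (f y) = 0 := by
    intro y hy
    have := h.density_le hy hx1
    rw [← heq, zero_mul] at this
    exact ENNReal.ofReal_of_nonpos this
  have h1 : μ (Iic x) = 0 := by
    rw [h.eq_withDensity, withDensity_apply _ measurableSet_Iic,
      setLIntegral_congr_fun measurableSet_Iic hf, lintegral_zero]
  rw [cdf_eq_real, measureReal_def, h1, ENNReal.toReal_zero]

/-- Beyond a median `a`, monotonicity gives `1 - F ≤ f / h(a)` with `h(a) > 0`, and `f` is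
integrable. This is why all the expectations are finite. -/
theorem integrableOn_tail [IsProbabilityMeasure μ] (h : IsMHRDensity μ f)
    (h0 : ∀ᵐ x ∂μ, 0 ≤ x) : IntegrableOn (fun x => 1 - cdf μ x) (Ioi 0) := by
  have := h.nullSingletonClass
  have hc : Continuous fun x => 1 - cdf μ x := continuous_const.sub (continuous_cdf μ)
  obtain ⟨a, ha, hFa⟩ := exists_cdf_eq (μ := μ) (a := 0) (q := 1 / 2)
    (by rw [cdf_zero_of_nonneg h0]; norm_num) (by norm_num)
  have hpos := h.hazardRate_pos (x := a) (by rw [hFa]; norm_num) (by rw [hFa]; norm_num)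
  rw [← Ioc_union_Ioi_eq_Ioi ha]
  refine IntegrableOn.union (hc.integrableOn_Ioc) ?_
  refine Integrable.mono' (h.integrable.integrableOn.const_mul (hazardRate μ f a)⁻¹)
    hc.aestronglyMeasurable ?_
  filter_upwards [ae_restrict_mem measurableSet_Ioi] with x hx
  rw [Real.norm_eq_abs, abs_of_nonneg (sub_nonneg.2 (cdf_le_one μ x)), inv_mul_eq_div,
    le_div_iff₀ hpos, mul_comm]
  exact h.le_density (le_of_lt hx) (by rw [hFa]; norm_num)

theorem integrableOn_tail_mul [IsProbabilityMeasure μ] (h : IsMHRDensity μ f)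
    (h0 : ∀ᵐ x ∂μ, 0 ≤ x) {g : ℝ → ℝ} (hg : Continuous g) :
    IntegrableOn (fun x => (1 - cdf μ x) * g (cdf μ x)) (Ioi 0) := by
  have := h.nullSingletonClass
  obtain ⟨C, hC⟩ := (isCompact_Icc (a := (0 : ℝ)) (b := 1)).exists_bound_of_continuousOn
    hg.continuousOn
  refine (h.integrableOn_tail h0).mul_bdd (c := C)
    (hg.comp (continuous_cdf μ)).aestronglyMeasurable (ae_of_all _ fun x => ?_)
  exact hC _ ⟨cdf_nonneg μ x, cdf_le_one μ x⟩

/-- If `g` changes sign once on `[0, 1]`, from nonnegative to nonpositive, then the sign of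
`∫ (1 - F) g(F)` is at least the one it has for the exponential distribution. -/
theorem integral_tail_mul_nonneg [IsProbabilityMeasure μ] (h : IsMHRDensity μ f)
    (h0 : ∀ᵐ x ∂μ, 0 ≤ x) {g : ℝ → ℝ} (hg : Continuous g) {q₀ : ℝ} (hq0 : 0 < q₀) (hq1 : q₀ < 1)
    (hpos : ∀ q, 0 ≤ q → q ≤ q₀ → 0 ≤ g q) (hneg : ∀ q, q₀ ≤ q → q ≤ 1 → g q ≤ 0)
    (hint : 0 ≤ ∫ q in (0 : ℝ)..1, g q) :
    0 ≤ ∫ x in Ioi 0, (1 - cdf μ x) * g (cdf μ x) := by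
  have := h.nullSingletonClass
  have hF0 := cdf_zero_of_nonneg h0
  have hc := continuous_cdf μ
  obtain ⟨a, ha, hFa⟩ := exists_cdf_eq (μ := μ) (a := 0) (q := q₀) (by rw [hF0]; exact hq0.le) hq1
  have hh : 0 < hazardRate μ f a := h.hazardRate_pos (hFa ▸ hq0) (hFa ▸ hq1)
  obtain ⟨C, hC⟩ := (isCompact_Icc (a := (0 : ℝ)) (b := 1)).exists_bound_of_continuousOn
    hg.continuousOn
  have hgf : Integrable fun x => g (cdf μ x) * f x :=
    h.integrable.bdd_mul (c := C) (hg.comp hc).aestronglyMeasurable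
      (ae_of_all _ fun x => hC _ ⟨cdf_nonneg μ x, cdf_le_one μ x⟩)
  -- The comparison of `f` with `h(a) (1 - F)` reverses at `a`, exactly where `g(F)` changes sign.
  have key : ∀ x, g (cdf μ x) * f x
      ≤ hazardRate μ f a * ((1 - cdf μ x) * g (cdf μ x)) := by
    intro x
    rw [← mul_assoc, mul_comm (g _)]
    rcases le_total x a with hx | hx
    · exact mul_le_mul_of_nonneg_right (h.density_le hx (hFa ▸ hq1))
        (hpos _ (cdf_nonneg μ x) (hFa ▸ monotone_cdf μ hx))
    · exact mul_le_mul_of_nonpos_right (h.le_density hx (hFa ▸ hq1))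
        (hneg _ (hFa ▸ monotone_cdf μ hx) (cdf_le_one μ x))
  have hμ : ∫ x in Ioi 0, g (cdf μ x) * f x = ∫ q in (0 : ℝ)..1, g q := by
    rw [← integral_comp_cdf h0 hg, h.integral_eq, ← integral_indicator measurableSet_Ioi]
    -- Since `F 0 = 0`, restricting to `Ioi 0` loses no mass; `f` itself may be nonzero on a null
    -- set there.
    have hf0 : ∀ᵐ x, x ∈ Iic (0 : ℝ) → f x = 0 := by
      have h1 : μ (Iic 0) = 0 := by rw [← ofReal_cdf, hF0, ENNReal.ofReal_zero]
      rw [h.eq_withDensity, withDensity_apply _ measurableSet_Iic,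
        lintegral_eq_zero_iff h.measurable.ennreal_ofReal] at h1
      filter_upwards [(ae_restrict_iff' measurableSet_Iic).1 h1] with x hx hx'
      exact le_antisymm (ENNReal.ofReal_eq_zero.1 (hx hx')) (h.nonneg x)
    refine integral_congr_ae ?_
    filter_upwards [hf0] with x hx
    by_cases hx0 : x ∈ Ioi (0 : ℝ)
    · rw [indicator_of_mem hx0]
    · rw [indicator_of_notMem hx0, hx (by simpa using hx0), mul_zero]
  have hle := integral_mono (hgf.integrableOn (s := Ioi 0))
    ((h.integrableOn_tail_mul h0 hg).const_mul (hazardRate μ f a)) key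
  rw [hμ, integral_const_mul] at hle
  exact nonneg_of_mul_nonneg_right (hint.trans hle) hh

end IsMHRDensity

/-! ### The comparison polynomial -/

/-- After division by `q ^ k` the polynomial is `c * ∑ q ^ (i - k) - b`, which is non-increasing for
`q > 0`. The cross-multiplied form also covers `q = 0`. -/
theorem geom_sub_pow_cross {b c s t : ℝ} (hc : 0 ≤ c) (k : ℕ) (hs : 0 ≤ s) (hst : s ≤ t) :
    s ^ k * (c * ∑ i ∈ Finset.range k, t ^ i - b * t ^ k)
      ≤ t ^ k * (c * ∑ i ∈ Finset.range k, s ^ i - b * s ^ k) := by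
  have h : s ^ k * ∑ i ∈ Finset.range k, t ^ i ≤ t ^ k * ∑ i ∈ Finset.range k, s ^ i := by
    rw [Finset.mul_sum, Finset.mul_sum]
    refine Finset.sum_le_sum fun i hi => ?_
    obtain ⟨d, rfl⟩ := Nat.exists_eq_add_of_le (Finset.mem_range.1 hi).le
    have h1 : s ^ d ≤ t ^ d := pow_le_pow_left₀ hs hst d
    have h2 : 0 ≤ s ^ i * t ^ i := mul_nonneg (pow_nonneg hs i) (pow_nonneg (hs.trans hst) i)
    calc s ^ (i + d) * t ^ i = s ^ i * t ^ i * s ^ d := by ring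
      _ ≤ s ^ i * t ^ i * t ^ d := mul_le_mul_of_nonneg_left h1 h2
      _ = t ^ (i + d) * s ^ i := by ring
  linarith [mul_le_mul_of_nonneg_left h hc]

/-- The value is `c > 0` at `0` and `c * k - b < 0` at `1`, so there is a root strictly between;
`geom_sub_pow_cross` against this root gives the signs on both sides. -/
theorem exists_crossing_geom_sub_pow {b c : ℝ} {k : ℕ} (hc : 0 < c) (hk : 1 ≤ k)
    (hb : c * k < b) :
    ∃ q₀ : ℝ, 0 < q₀ ∧ q₀ < 1 ∧
      (∀ q, 0 ≤ q → q ≤ q₀ → 0 ≤ c * ∑ i ∈ Finset.range k, q ^ i - b * q ^ k) ∧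
      (∀ q, q₀ ≤ q → c * ∑ i ∈ Finset.range k, q ^ i - b * q ^ k ≤ 0) := by
  set p : ℝ → ℝ := fun q => c * ∑ i ∈ Finset.range k, q ^ i - b * q ^ k with hp
  have hcont : Continuous p := by fun_prop
  have p0 : p 0 = c := by
    obtain ⟨m, rfl⟩ := Nat.exists_eq_add_of_le' hk
    simp [hp, Finset.sum_range_succ']
  have p1 : p 1 < 0 := by simpa [hp] using hb
  obtain ⟨q₀, hq, hq0⟩ := intermediate_value_Icc' (zero_le_one' ℝ) hcont.continuousOn
    (show (0 : ℝ) ∈ Icc (p 1) (p 0) from ⟨p1.le, p0 ▸ hc.le⟩)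
  have hpos : 0 < q₀ := hq.1.lt_of_ne fun h => by rw [← h, p0] at hq0; exact hc.ne' hq0
  have hlt : q₀ < 1 := hq.2.lt_of_ne fun h => by rw [h] at hq0; exact p1.ne hq0
  refine ⟨q₀, hpos, hlt, fun q h1 h2 => ?_, fun q h1 => ?_⟩
  · have h := geom_sub_pow_cross (b := b) hc.le k h1 h2
    have : q ^ k * p q₀ ≤ q₀ ^ k * p q := h
    rw [hq0, mul_zero] at this
    exact nonneg_of_mul_nonneg_right this (pow_pos hpos k)
  · have h := geom_sub_pow_cross (b := b) hc.le k hpos.le h1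
    have : q₀ ^ k * p q ≤ q ^ k * p q₀ := h
    rw [hq0, mul_zero] at this
    exact nonpos_of_mul_nonpos_right this (pow_pos hpos k)

theorem integral_pow_mul_geom_sub_pow (b c : ℝ) (j k : ℕ) :
    ∫ q in (0 : ℝ)..1, q ^ j * (c * ∑ i ∈ Finset.range k, q ^ i - b * q ^ k)
      = c * ∑ i ∈ Finset.range k, 1 / ((j + i : ℕ) + 1 : ℝ) - b / ((j + k : ℕ) + 1 : ℝ) := by
  have h : ∀ q : ℝ, q ^ j * (c * ∑ i ∈ Finset.range k, q ^ i - b * q ^ k)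
      = c * ∑ i ∈ Finset.range k, q ^ (j + i) - b * q ^ (j + k) := by
    intro q
    simp only [pow_add, ← Finset.mul_sum]
    ring
  simp only [h]
  rw [intervalIntegral.integral_sub
    ((by fun_prop : Continuous _).intervalIntegrable _ _)
    ((by fun_prop : Continuous _).intervalIntegrable _ _),
    intervalIntegral.integral_const_mul, intervalIntegral.integral_const_mul,
    intervalIntegral.integral_finsetSum fun i _ =>
      (by fun_prop : Continuous _).intervalIntegrable _ _]
  simp only [integral_pow, one_pow, ne_eq, Nat.add_eq_zero_iff, one_ne_zero, and_false,
    not_false_eq_true, zero_pow, sub_zero]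
  ring

namespace IsMHRDensity

variable {μ : Measure ℝ} {f : ℝ → ℝ}

/-- `hexp` says that `∫₀¹ g ≥ 0`, the exponential case. The factor `1 - F` telescopes the geometric
sum to `1 - F ^ k`. -/
theorem integral_geom_sub_pow_nonneg [IsProbabilityMeasure μ] (h : IsMHRDensity μ f)
    (h0 : ∀ᵐ x ∂μ, 0 ≤ x) {b c : ℝ} {j k : ℕ} (hc : 0 < c) (hk : 1 ≤ k) (hb : c * k < b)
    (hexp : b / ((j + k : ℕ) + 1 : ℝ)
      ≤ c * ∑ i ∈ Finset.range k, 1 / ((j + i : ℕ) + 1 : ℝ)) :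
    0 ≤ ∫ x in Ioi 0,
      cdf μ x ^ j * (c * (1 - cdf μ x ^ k) - b * (cdf μ x ^ k * (1 - cdf μ x))) := by
  obtain ⟨q₀, h1, h2, h3, h4⟩ := exists_crossing_geom_sub_pow hc hk hb
  have key := h.integral_tail_mul_nonneg h0
    (g := fun q => q ^ j * (c * ∑ i ∈ Finset.range k, q ^ i - b * q ^ k)) (by fun_prop) h1 h2
    (fun q hq hq' => mul_nonneg (pow_nonneg hq j) (h3 q hq hq'))
    (fun q hq _ => mul_nonpos_of_nonneg_of_nonpos (pow_nonneg (h1.le.trans hq) j) (h4 q hq))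
    (by rw [integral_pow_mul_geom_sub_pow]; exact sub_nonneg.2 hexp)
  refine key.trans_eq (integral_congr_ae (ae_of_all _ fun x => ?_))
  simp only [← mul_neg_geom_sum]
  ring

theorem integrableOn_one_sub_pow [IsProbabilityMeasure μ] (h : IsMHRDensity μ f)
    (h0 : ∀ᵐ x ∂μ, 0 ≤ x) (n : ℕ) : IntegrableOn (fun x => 1 - cdf μ x ^ n) (Ioi 0) := by
  have := h.integrableOn_tail_mul h0 (g := fun q => ∑ i ∈ Finset.range n, q ^ i) (by fun_prop)
  simpa only [mul_neg_geom_sum] using this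

theorem integrableOn_one_sub_add [IsProbabilityMeasure μ] (h : IsMHRDensity μ f)
    (h0 : ∀ᵐ x ∂μ, 0 ≤ x) (n : ℕ) :
    IntegrableOn (fun x => 1 - (cdf μ x ^ n + n * (cdf μ x ^ (n - 1) * (1 - cdf μ x))))
      (Ioi 0) := by
  have h1 := h.integrableOn_tail_mul h0 (g := fun q => n * q ^ (n - 1)) (by fun_prop)
  refine ((h.integrableOn_one_sub_pow h0 n).sub h1).congr (ae_of_all _ fun x => ?_)
  simp only [Pi.sub_apply]
  ring

theorem integrable_id [IsProbabilityMeasure μ] (h : IsMHRDensity μ f) (h0 : ∀ᵐ x ∂μ, 0 ≤ x) :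
    Integrable (fun x => x) μ :=
  integrable_id_of_integrableOn_tail h0 (h.integrableOn_tail h0)

theorem mul_expectedOrderStat_one_le [IsProbabilityMeasure μ] (h : IsMHRDensity μ f)
    (h0 : ∀ᵐ x ∂μ, 0 ≤ x) {n m : ℕ} (hn : 1 ≤ n) (hm : 2 ≤ m) {a b c : ℝ} {j k : ℕ}
    (hc : 0 < c) (hk : 1 ≤ k) (hb : c * k < b)
    (hexp : b / ((j + k : ℕ) + 1 : ℝ)
      ≤ c * ∑ i ∈ Finset.range k, 1 / ((j + i : ℕ) + 1 : ℝ))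
    (hpoly : ∀ q : ℝ, q ^ j * (c * (1 - q ^ k) - b * (q ^ k * (1 - q)))
      = 1 - (q ^ m + m * (q ^ (m - 1) * (1 - q))) - a * (1 - q ^ n)) :
    a * expectedOrderStat μ 1 n ≤ expectedOrderStat μ 2 m := by
  have := h.integral_geom_sub_pow_nonneg h0 hc hk hb hexp
  simp only [hpoly] at this
  rw [integral_sub (h.integrableOn_one_sub_add h0 m)
    ((h.integrableOn_one_sub_pow h0 n).const_mul a), integral_const_mul] at this
  rw [expectedOrderStat_one h0 (h.integrable_id h0) hn,
    expectedOrderStat_two h0 (h.integrable_id h0) hm]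
  linarith

end IsMHRDensity

/-! ### Harmonic sums -/

theorem one_add_harmonic_le_harmonic_four_mul {n : ℕ} (hn : 1 ≤ n) :
    1 + ∑ i ∈ Finset.range n, 1 / ((i : ℕ) + 1 : ℝ)
      ≤ ∑ i ∈ Finset.range (4 * n), 1 / ((i : ℕ) + 1 : ℝ) := by
  induction n, hn using Nat.le_induction with
  | base => norm_num [Finset.sum_range_succ]
  | succ n hn ih =>
    rw [show 4 * (n + 1) = 4 * n + 1 + 1 + 1 + 1 by ring]
    simp only [Finset.sum_range_succ _ n, Finset.sum_range_succ _ (4 * n),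
      Finset.sum_range_succ _ (4 * n + 1), Finset.sum_range_succ _ (4 * n + 1 + 1),
      Finset.sum_range_succ _ (4 * n + 1 + 1 + 1)]
    push_cast
    have hx : (0 : ℝ) < n + 1 := by positivity
    have e : ∀ y : ℝ, 0 < y → y ≤ 4 * ((n : ℝ) + 1) → 1 / (4 * ((n : ℝ) + 1)) ≤ 1 / y :=
      fun y h1 h2 => one_div_le_one_div_of_le h1 h2
    have e1 := e (4 * n + 1) (by positivity) (by linarith)
    have e2 := e (4 * n + 1 + 1) (by positivity) (by linarith)
    have e3 := e (4 * n + 1 + 1 + 1) (by positivity) (by linarith)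
    have e4 := e (4 * n + 1 + 1 + 1 + 1) (by positivity) (by linarith)
    -- The four new terms on the right are each at least `1 / (4 (n + 1))`, so together they pay for
    -- the one new term on the left.
    have e5 : 4 * (1 / (4 * ((n : ℝ) + 1))) = 1 / ((n : ℝ) + 1) := by field_simp
    linarith

/-- Induction on increments; equality holds at `n = 0` and `n = 1`. -/
theorem div_succ_le_half_harmonic (n : ℕ) :
    (n : ℝ) / (n + 1) ≤ 1 / 2 * ∑ i ∈ Finset.range n, 1 / ((i : ℕ) + 1 : ℝ) := by
  induction n with
  | zero => simp
  | succ n ih =>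
    rw [Finset.sum_range_succ, mul_add]
    push_cast
    have h : ((n : ℝ) + 1) / (n + 1 + 1) ≤ n / (n + 1) + 1 / 2 * (1 / (n + 1)) := by
      rw [← sub_nonneg]
      have : (n : ℝ) / (n + 1) + 1 / 2 * (1 / (n + 1)) - (n + 1) / (n + 1 + 1)
          = n / (2 * (n + 1) * (n + 1 + 1)) := by
        field_simp
        ring
      rw [this]
      positivity
    linarith

theorem div_le_two_thirds_harmonic (m : ℕ) :
    ((m : ℝ) + 4 / 3) / (m + 2)
      ≤ 2 / 3 * ∑ i ∈ Finset.range (m + 1), 1 / ((i : ℕ) + 1 : ℝ) := by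
  induction m with
  | zero => norm_num
  | succ m ih =>
    rw [Finset.sum_range_succ, mul_add]
    push_cast
    have h : ((m : ℝ) + 1 + 4 / 3) / (m + 1 + 2)
        ≤ (m + 4 / 3) / (m + 2) + 2 / 3 * (1 / (m + 1 + 1)) := by
      rw [← sub_nonneg]
      have : ((m : ℝ) + 4 / 3) / (m + 2) + 2 / 3 * (1 / (m + 1 + 1)) - (m + 1 + 4 / 3) / (m + 1 + 2)
          = 2 * (m + 2) / (3 * (m + 2) * (m + 3)) := by
        have h1 : (m : ℝ) + 1 + 1 = m + 2 := by ring
        have h2 : (m : ℝ) + 1 + 2 = m + 3 := by ring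
        rw [h1, h2]
        field_simp
        ring
      rw [this]
      positivity
    linarith

/-! ### The three inequalities -/

namespace IsMHRDensity

variable {μ : Measure ℝ} {f : ℝ → ℝ}

/-- Here `g` has the factor `q ^ n`, and the exponential case is `H_{4n} ≥ 1 + H_n`, rewritten as `1
- 1/(4n) ≤ H_{4n-1} - H_n`. -/
theorem expectedOrderStat_one_le_two_four_mul [IsProbabilityMeasure μ] (h : IsMHRDensity μ f)
    (h0 : ∀ᵐ x ∂μ, 0 ≤ x) {n : ℕ} (hn : 1 ≤ n) :
    expectedOrderStat μ 1 n ≤ expectedOrderStat μ 2 (4 * n) := by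
  have hn' : (1 : ℝ) ≤ n := by exact_mod_cast hn
  have hc : ((3 * n - 1 : ℕ) : ℝ) = 3 * n - 1 := by
    rw [Nat.cast_sub (by omega)]; push_cast; ring
  have key := h.mul_expectedOrderStat_one_le h0 (n := n) (m := 4 * n) (a := 1) (b := 4 * n - 1)
    (c := 1) (j := n) (k := 3 * n - 1) hn (by omega) one_pos (by omega)
    (by rw [hc]; linarith) ?_ ?_
  · rwa [one_mul] at key
  · have hH := one_add_harmonic_le_harmonic_four_mul hn
    rw [show 4 * n = n + (3 * n - 1) + 1 by omega, Finset.sum_range_succ,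
      Finset.sum_range_add] at hH
    have e : ((n + (3 * n - 1) : ℕ) : ℝ) + 1 = 4 * n := by
      rw [Nat.cast_add, hc]; ring
    rw [e] at hH ⊢
    rw [sub_div, div_self (by positivity), one_mul]
    linarith
  · intro q
    have e1 : q ^ (4 * n) = q ^ n * q ^ (3 * n - 1) * q := by
      rw [← pow_add, ← pow_succ]; congr 1; omega
    have e2 : q ^ (4 * n - 1) = q ^ n * q ^ (3 * n - 1) := by
      rw [← pow_add]; congr 1; omega
    rw [e1, e2]
    push_cast
    ring

/-- Of the constant `1/e` only `0 < 1/e ≤ 1/2` is used: the exponential case is `n / (n + 1) ≤ (1 -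
1/e) H_n`. -/
theorem inv_exp_mul_expectedOrderStat_one_le [IsProbabilityMeasure μ] (h : IsMHRDensity μ f)
    (h0 : ∀ᵐ x ∂μ, 0 ≤ x) {n : ℕ} (hn : 1 ≤ n) :
    (1 / Real.exp 1) * expectedOrderStat μ 1 n ≤ expectedOrderStat μ 2 (n + 1) := by
  have he : 0 < 1 / Real.exp 1 := by positivity
  have he2 : 1 / Real.exp 1 ≤ 1 / 2 :=
    one_div_le_one_div_of_le two_pos (by linarith [Real.add_one_le_exp 1])
  have hn' : (1 : ℝ) ≤ n := by exact_mod_cast hn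
  refine h.mul_expectedOrderStat_one_le h0 (b := n) (c := 1 - 1 / Real.exp 1) (j := 0) (k := n)
    hn (by omega) (by linarith) hn (by nlinarith) ?_ ?_
  · simp only [zero_add]
    exact (div_succ_le_half_harmonic n).trans (mul_le_mul_of_nonneg_right (by linarith)
      (Finset.sum_nonneg fun i _ => by positivity))
  · intro q
    simp only [Nat.add_sub_cancel, pow_succ, pow_zero]
    push_cast
    ring

theorem third_mul_expectedOrderStat_one_le [IsProbabilityMeasure μ] (h : IsMHRDensity μ f)
    (h0 : ∀ᵐ x ∂μ, 0 ≤ x) {n : ℕ} (hn : 2 ≤ n) :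
    (1 / 3) * expectedOrderStat μ 1 n ≤ expectedOrderStat μ 2 n := by
  obtain ⟨m, rfl⟩ := Nat.exists_eq_add_of_le' hn
  -- Splitting `q ^ (m + 2)` as `q ^ (m + 1) - q ^ (m + 1) * (1 - q)` moves `2/3` out of the
  -- coefficient `m + 2`, leaving `b = m + 4/3`.
  refine h.mul_expectedOrderStat_one_le h0 (b := m + 4 / 3) (c := 2 / 3) (j := 0) (k := m + 1)
    (by omega) hn (by norm_num) (by omega) ?_ ?_ ?_
  · push_cast
    linarith [(Nat.cast_nonneg m : (0 : ℝ) ≤ m)]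
  · simp only [zero_add]
    convert div_le_two_thirds_harmonic m using 2
    push_cast
    ring
  · intro q
    rw [show m + 2 - 1 = m + 1 by omega]
    simp only [pow_succ, pow_zero]
    push_cast
    ring

end IsMHRDensity

/-! ### A bounded distribution for which three samples do not suffice -/

/-- The density `2 (1 - x)` on `[0, 1]`. -/
noncomputable def triangleDensity : ℝ → ℝ :=
  (Icc 0 1).indicator fun x => 2 * (1 - x)

/-- The distribution with density `2 (1 - x)` on `[0, 1]`. -/
noncomputable def triangleMeasure : Measure ℝ :=
  volume.withDensity fun x => ENNReal.ofReal (triangleDensity x)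

theorem measurable_triangleDensity : Measurable triangleDensity :=
  Measurable.indicator (by fun_prop) measurableSet_Icc

theorem triangleDensity_nonneg (x : ℝ) : 0 ≤ triangleDensity x :=
  indicator_nonneg (fun y hy => by linarith [hy.2]) x

/-- Stated for a general `s` so as to give the mass of `univ`, of `Icc 0 1` and of `Iic x` at once.
-/
theorem triangleMeasure_apply_of_inter_eq {s : Set ℝ} (hs : MeasurableSet s) {x : ℝ}
    (hx0 : 0 ≤ x) (h : s ∩ Icc 0 1 = Icc 0 x) :
    triangleMeasure s = ENNReal.ofReal (1 - (1 - x) ^ 2) := by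
  have hint : IntegrableOn triangleDensity s :=
    ((by fun_prop : Continuous fun x : ℝ => 2 * (1 - x)).integrableOn_Icc.integrable_indicator
      measurableSet_Icc).integrableOn
  rw [triangleMeasure, withDensity_apply _ hs, ← ofReal_integral_eq_lintegral_ofReal hint
    (ae_of_all _ triangleDensity_nonneg), triangleDensity, setIntegral_indicator measurableSet_Icc,
    h, integral_Icc_eq_integral_Ioc, ← intervalIntegral.integral_of_le hx0]
  congr 1
  have hd : ∀ y ∈ uIcc 0 x, HasDerivAt (fun t : ℝ => 1 - (1 - t) ^ 2) (2 * (1 - y)) y := by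
    intro y _
    exact ((((hasDerivAt_id' y).const_sub 1).fun_pow 2).const_sub 1).congr_deriv (by norm_num)
  rw [intervalIntegral.integral_eq_sub_of_hasDerivAt hd
    ((by fun_prop : Continuous fun x : ℝ => 2 * (1 - x)).intervalIntegrable _ _)]
  norm_num

instance isProbabilityMeasure_triangleMeasure : IsProbabilityMeasure triangleMeasure := by
  refine ⟨?_⟩
  rw [triangleMeasure_apply_of_inter_eq MeasurableSet.univ zero_le_one (univ_inter _)]
  norm_num

theorem ae_mem_Icc_triangleMeasure : ∀ᵐ x ∂triangleMeasure, 0 ≤ x ∧ x ≤ 1 := by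
  have h : triangleMeasure (Icc 0 1) = 1 := by
    rw [triangleMeasure_apply_of_inter_eq measurableSet_Icc zero_le_one (inter_self _)]
    norm_num
  exact (prob_compl_eq_zero_iff measurableSet_Icc).2 h

theorem cdf_triangleMeasure_of_mem {x : ℝ} (hx0 : 0 ≤ x) (hx1 : x ≤ 1) :
    cdf triangleMeasure x = 1 - (1 - x) ^ 2 := by
  rw [cdf_eq_real, measureReal_def, triangleMeasure_apply_of_inter_eq measurableSet_Iic hx0,
    ENNReal.toReal_ofReal]
  · nlinarith
  · ext y
    simp only [mem_inter_iff, mem_Iic, mem_Icc]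
    exact ⟨fun h => ⟨h.2.1, h.1⟩, fun h => ⟨h.2, h.1, h.2.trans hx1⟩⟩

theorem cdf_triangleMeasure_of_one_le {x : ℝ} (hx : 1 ≤ x) : cdf triangleMeasure x = 1 := by
  refine le_antisymm (cdf_le_one _ _) ?_
  have h := monotone_cdf triangleMeasure hx
  rw [cdf_triangleMeasure_of_mem zero_le_one le_rfl] at h
  linarith

theorem isMHRDensity_triangleMeasure : IsMHRDensity triangleMeasure triangleDensity where
  measurable := measurable_triangleDensity
  nonneg := triangleDensity_nonneg
  eq_withDensity := rfl
  monotoneOn := by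
    intro x hx y hy hxy
    have lt_one : ∀ z, cdf triangleMeasure z < 1 → z < 1 := fun z hz =>
      not_le.1 fun h => hz.ne (cdf_triangleMeasure_of_one_le h)
    have hy1 := lt_one y hy
    rcases lt_or_ge x 0 with hx0 | hx0
    · have h1 : hazardRate triangleMeasure triangleDensity x = 0 := by
        rw [hazardRate, triangleDensity, indicator_of_notMem fun h => hx0.not_ge h.1, zero_div]
      rw [h1]
      exact div_nonneg (triangleDensity_nonneg y) (sub_pos.2 hy).le
    · have formula : ∀ z, 0 ≤ z → z < 1 →
          hazardRate triangleMeasure triangleDensity z = 2 / (1 - z) := by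
        intro z h0 h1
        have : 1 - z ≠ 0 := (sub_pos.2 h1).ne'
        rw [hazardRate, triangleDensity, indicator_of_mem (mem_Icc.2 ⟨h0, h1.le⟩),
          cdf_triangleMeasure_of_mem h0 h1.le]
        field_simp
        ring
      rw [formula x hx0 (hxy.trans_lt hy1), formula y (hx0.trans hxy) hy1]
      exact div_le_div_of_nonneg_left zero_le_two (sub_pos.2 hy1) (by linarith)

theorem setIntegral_comp_cdf_triangleMeasure {g : ℝ → ℝ} (hg : g 1 = 0) :
    ∫ x in Ioi 0, g (cdf triangleMeasure x) = ∫ x in (0 : ℝ)..1, g (1 - (1 - x) ^ 2) := by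
  rw [intervalIntegral.integral_of_le zero_le_one,
    ← setIntegral_congr_fun (f := fun x => g (cdf triangleMeasure x)) measurableSet_Ioc
      fun x hx => by simp only [cdf_triangleMeasure_of_mem hx.1.le hx.2]]
  refine (setIntegral_eq_of_subset_of_forall_sdiff_eq_zero measurableSet_Ioi
    Ioc_subset_Ioi_self fun x hx => ?_)
  have hx1 : 1 ≤ x := by
    by_contra hlt
    exact hx.2 ⟨hx.1, (not_le.1 hlt).le⟩
  rw [cdf_triangleMeasure_of_one_le hx1, hg]

theorem expectedOrderStat_triangleMeasure :
    expectedOrderStat triangleMeasure 1 1 = 1 / 3 ∧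
      expectedOrderStat triangleMeasure 2 2 = 1 / 5 ∧
      expectedOrderStat triangleMeasure 2 3 = 11 / 35 := by
  have h0 : ∀ᵐ x ∂triangleMeasure, 0 ≤ x := ae_mem_Icc_triangleMeasure.mono fun x hx => hx.1
  have hi := isMHRDensity_triangleMeasure.integrable_id h0
  have hpow : ∀ k : ℕ, ∫ x in (0 : ℝ)..1, (1 - x) ^ k = 1 / (k + 1) := by
    intro k
    rw [intervalIntegral.integral_comp_sub_left (fun x : ℝ => x ^ k) 1]
    simp
  refine ⟨?_, ?_, ?_⟩
  · rw [expectedOrderStat_one h0 hi le_rfl,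
      setIntegral_comp_cdf_triangleMeasure (g := fun q => 1 - q ^ 1) (by norm_num)]
    simp only [pow_one, sub_sub_cancel]
    rw [hpow 2]
    norm_num
  · rw [expectedOrderStat_two h0 hi le_rfl, setIntegral_comp_cdf_triangleMeasure
      (g := fun q => 1 - (q ^ 2 + (2 : ℕ) * (q ^ (2 - 1) * (1 - q)))) (by norm_num)]
    -- With `s = 1 - F = (1 - x) ^ 2`, the tail of the second highest is `s ^ 2` for two samples and
    -- `3 s ^ 2 - 2 s ^ 3` for three.
    have e : ∀ x : ℝ, 1 - ((1 - (1 - x) ^ 2) ^ 2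
        + (2 : ℕ) * ((1 - (1 - x) ^ 2) ^ (2 - 1) * (1 - (1 - (1 - x) ^ 2)))) = (1 - x) ^ 4 := by
      intro x
      norm_num
      ring
    simp only [e]
    rw [hpow 4]
    norm_num
  · rw [expectedOrderStat_two h0 hi (by norm_num), setIntegral_comp_cdf_triangleMeasure
      (g := fun q => 1 - (q ^ 3 + (3 : ℕ) * (q ^ (3 - 1) * (1 - q)))) (by norm_num)]
    have e : ∀ x : ℝ, 1 - ((1 - (1 - x) ^ 2) ^ 3
        + (3 : ℕ) * ((1 - (1 - x) ^ 2) ^ (3 - 1) * (1 - (1 - (1 - x) ^ 2))))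
        = 3 * (1 - x) ^ 4 - 2 * (1 - x) ^ 6 := by
      intro x
      norm_num
      ring
    simp only [e]
    rw [intervalIntegral.integral_sub ((by fun_prop : Continuous _).intervalIntegrable _ _)
      ((by fun_prop : Continuous _).intervalIntegrable _ _),
      intervalIntegral.integral_const_mul, intervalIntegral.integral_const_mul, hpow 4, hpow 6]
    norm_num

theorem mainTheorem3 :
    (∀ μ : MeasureTheory.Measure ℝ, MeasureTheory.IsProbabilityMeasure μ → IsMHR μ →
      (∀ᵐ x ∂μ, 0 ≤ x) →
        (∀ r n : ℕ, 1 ≤ r → r ≤ n →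
          MeasureTheory.Integrable (fun v : Fin n → ℝ => orderStat r v) (iidLaw μ n)) ∧
        (∀ n : ℕ, 1 ≤ n → expectedOrderStat μ 2 (4 * n) ≥ expectedOrderStat μ 1 n) ∧
        (∀ n : ℕ, 1 ≤ n →
          expectedOrderStat μ 2 (n + 1) ≥ (1 / Real.exp 1) * expectedOrderStat μ 1 n) ∧
        (∀ n : ℕ, 2 ≤ n →
          expectedOrderStat μ 2 n ≥ (1 / 3 : ℝ) * expectedOrderStat μ 1 n)) ∧
    (∃ μ : MeasureTheory.Measure ℝ, MeasureTheory.IsProbabilityMeasure μ ∧ IsMHR μ ∧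
      (∃ V : ℝ, ∀ᵐ x ∂μ, 0 ≤ x ∧ x ≤ V) ∧
      ∀ m : ℕ, 2 ≤ m → m < 4 → expectedOrderStat μ 2 m < expectedOrderStat μ 1 1) := by
  refine ⟨fun μ _ hμ h0 => ?_, ?_⟩
  · obtain ⟨f, h1, h2, h3, h4⟩ := hμ
    have h : IsMHRDensity μ f := ⟨h1, h2, h3, h4⟩
    exact ⟨fun r n hr hrn => integrable_orderStat (h.integrable_id h0) hr hrn,
      fun n hn => h.expectedOrderStat_one_le_two_four_mul h0 hn,
      fun n hn => h.inv_exp_mul_expectedOrderStat_one_le h0 hn,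
      fun n hn => h.third_mul_expectedOrderStat_one_le h0 hn⟩
  · have h := isMHRDensity_triangleMeasure
    refine ⟨triangleMeasure, inferInstance,
      ⟨triangleDensity, h.measurable, h.nonneg, h.eq_withDensity, h.monotoneOn⟩,
      ⟨1, ae_mem_Icc_triangleMeasure⟩, fun m hm hm' => ?_⟩
    obtain ⟨e1, e2, e3⟩ := expectedOrderStat_triangleMeasure
    interval_cases m
    · rw [e1, e2]; norm_num
    · rw [e1, e3]; norm_num
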